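/- Let $A \subseteq \mathbb{R}^d$ be a closed convex set, $Y$ a real Banach space with topological dual $Y^*$, $K \subseteq Y$ a closed convex cone, $W$ a nonempty compact Hausdorff space, and let $f \colon \mathbb{R}^d \times W \to \mathbb{R}$ and $G \colon \mathbb{R}^d \to Y$. Put $F(x) = \max_{\omega \in W} f(x, \omega)$ and consider the problem $$ (\mathcal{P}) \qquad \min F(x) \quad \text{subject to} \quad G(x) \in K, \quad x \in A. $$ Let $x_*$ be a feasible point with an open neighbourhood $U$ such that $f$ is differentiable in $x$ on $U$ for every $\omega \in W$, the maps $f$ and $\nabla_x f$ are jointly continuous on $U \times W$, and $G$ is continuously Fréchet differentiable on $U$. (Values of $F$ are only relevant near $x_*$.) For a subset $C$ of a normed space $X$ and $x \in C$, let the contingent cone $T_C(x)$ be the set of all $h \in X$ for which there are $\alpha_n > 0$ and $h_n \in X$ with $\alpha_n \to 0$, $h_n \to h$ and $x + \alpha_n h_n \in C$ for all $n \in \mathbb{N}$. Let $W(x_*) = \{ \omega \in W : f(x_*, \omega) = F(x_*) \}$, $K^* = \{ y^* \in Y^* : \langle y^*, y \rangle \le 0 \ \forall y \in K \}$ and $L(x,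 \lambda) = F(x) + \langle \lambda, G(x) \rangle$. A functional $\lambda \in Y^*$ is a Lagrange multiplier of $(\mathcal{P})$ at $x_*$ if $\lambda \in K^*$, $\langle \lambda, G(x_*) \rangle = 0$, and for every $h \in T_A(x_*)$ the directional derivative $[L(\cdot, \lambda)]'(x_*, h) = \lim_{t \to +0} \frac{L(x_* + t h, \lambda) - L(x_*, \lambda)}{t}$ exists and is nonnegative. Suppose that $x_*$ is a locally optimal solution of $(\mathcal{P})$ and that Robinson's constraint qualification holds at $x_*$, that is, $$ 0 \in \operatorname{int} \{ G(x_*) + D G(x_*)(A - x_*) - K \}. $$ Then: 1. $h = 0$ is a globally optimal solution of the linearised problem $$ \min_{h \in \mathbb{R}^d} \ \max_{\omega \in W(x_*)} \langle \nabla_x f(x_*, \omega), h \rangle \quad \text{subject to} \quad D G(x_*) h \in T_K(G(x_*)), \quad h \in T_A(x_*). $$ 2. The set of Lagrange multipliers of $(\mathcal{P})$ at $x_*$ is a nonempty, convex, bounded and weak$^*$ compact subset of $Y^*$. -/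

import Mathlib

open Set Filter Topology

namespace ConeMinimax

noncomputable section

/-- The contingent (Bouligand tangent) cone to `C` at `x`: all `h` for which there are `αₙ > 0` and
`hₙ` with `αₙ → 0`, `hₙ → h` and `x + αₙ hₙ ∈ C` for all `n`. -/
def contingentCone {X : Type*} [NormedAddCommGroup X] [NormedSpace ℝ X] (C : Set X) (x : X) :
    Set X :=
  {h | ∃ (α : ℕ → ℝ) (u : ℕ → X), (∀ n, 0 < α n) ∧ Tendsto α atTop (𝓝 0) ∧
    Tendsto u atTop (𝓝 h) ∧ ∀ n, x + α n • u n ∈ C}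

/-- The polar cone `K* = {y* ∈ Y* : ⟨y*, y⟩ ≤ 0 for all y ∈ K}`. -/
def polarCone {Y : Type*} [NormedAddCommGroup Y] [NormedSpace ℝ Y] (K : Set Y) :
    Set (StrongDual ℝ Y) :=
  {l | ∀ y ∈ K, l y ≤ 0}

/-- `φ` has the (one-sided) directional derivative `D` at `x` in the direction `h`:
`(φ (x + t h) - φ x) / t → D` as `t → +0`. -/
def HasDirDeriv {X : Type*} [NormedAddCommGroup X] [NormedSpace ℝ X] (φ : X → ℝ) (x h : X)
    (D : ℝ) : Prop :=
  Tendsto (fun t : ℝ => (φ (x + t • h) - φ x) / t) (𝓝[>] 0) (𝓝 D)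

/-- The feasible region `Ω = {x ∈ A : G x ∈ K}`. -/
def feasibleSet {X Y : Type*} (A : Set X) (K : Set Y) (G : X → Y) : Set X :=
  {x | x ∈ A ∧ G x ∈ K}

/-- The objective `F x = max_{ω ∈ W} f x ω`. -/
def maxFun {X W : Type*} (f : X → W → ℝ) (x : X) : ℝ := ⨆ ω, f x ω

/-- The set of active indices `W(x) = {ω : f x ω = F x}`. -/
def activeSet {X W : Type*} (f : X → W → ℝ) (x : X) : Set W := {ω | f x ω = maxFun f x}

/-- Robinson's constraint qualification at `x`:
`0 ∈ int {G x + DG(x)(A - x) - K}`. -/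
def RCQ {X Y : Type*} [NormedAddCommGroup X] [NormedSpace ℝ X]
    [NormedAddCommGroup Y] [NormedSpace ℝ Y] (A : Set X) (K : Set Y) (G : X → Y) (x : X) : Prop :=
  (0 : Y) ∈ interior {y | ∃ a ∈ A, ∃ k ∈ K, y = G x + fderiv ℝ G x (a - x) - k}

/-- The Lagrangian `L(x, l) = F x + ⟨l, G x⟩`. -/
def lagrangian {X Y W : Type*} [NormedAddCommGroup Y] [NormedSpace ℝ Y]
    (f : X → W → ℝ) (G : X → Y) (x : X) (l : StrongDual ℝ Y) : ℝ :=
  maxFun f x + l (G x)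

/-- The set of Lagrange multipliers at `x`: all `l ∈ K*` with `⟨l, G x⟩ = 0` such that
`L(·, l)` has a nonnegative directional derivative at `x` in every direction `h ∈ T_A(x)`. -/
def lagrangeMultipliers {X Y W : Type*} [NormedAddCommGroup X] [NormedSpace ℝ X]
    [NormedAddCommGroup Y] [NormedSpace ℝ Y] (A : Set X) (K : Set Y)
    (f : X → W → ℝ) (G : X → Y) (x : X) : Set (StrongDual ℝ Y) :=
  {l | l ∈ polarCone K ∧ l (G x) = 0 ∧
    ∀ h ∈ contingentCone A x, ∃ D : ℝ, HasDirDeriv (fun z => lagrangian f G z l) x h D ∧ 0 ≤ D}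

/-- The objective `h ↦ max_{ω ∈ W(x)} ⟨∇ₓ f(x, ω), h⟩` of the linearised problem. -/
def linearisedObjective {X W : Type*} [NormedAddCommGroup X] [InnerProductSpace ℝ X]
    [CompleteSpace X] (f : X → W → ℝ) (x h : X) : ℝ :=
  ⨆ ω : activeSet f x, inner ℝ (gradient (fun z => f z ω) x) h

/-- The feasible set `{h ∈ T_A(x) : DG(x) h ∈ T_K(G x)}` of the linearised problem. -/
def linearisedFeasibleSet {X Y : Type*} [NormedAddCommGroup X] [NormedSpace ℝ X]
    [NormedAddCommGroup Y] [NormedSpace ℝ Y] (A : Set X) (K : Set Y) (G : X → Y) (x : X) : Set X :=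
  {h | h ∈ contingentCone A x ∧ fderiv ℝ G x h ∈ contingentCone K (G x)}

/-- The supremum defining `F x` is a maximum when `f x` is continuous on a nonempty compact `W`. -/
theorem isGreatest_maxFun {X W : Type*} [TopologicalSpace W] [CompactSpace W] [Nonempty W]
    (f : X → W → ℝ) (x : X) (hf : Continuous (f x)) : IsGreatest (range (f x)) (maxFun f x) :=
  (isCompact_range hf).isGreatest_sSup (range_nonempty _)

/-- The supremum defining the linearised objective is a maximum. -/
theorem isGreatest_linearisedObjective {X W : Type*} [NormedAddCommGroup X]
    [InnerProductSpace ℝ X] [CompleteSpace X] [TopologicalSpace W] [CompactSpace W] [Nonempty W]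
    (f : X → W → ℝ) (x h : X) (hf : Continuous (f x))
    (hg : Continuous fun ω => gradient (fun z => f z ω) x) :
    IsGreatest ((fun ω => inner ℝ (gradient (fun z => f z ω) x) h) '' activeSet f x)
      (linearisedObjective f x h) := by
  have hcl : IsClosed (activeSet f x) := isClosed_eq hf continuous_const
  have hne : (activeSet f x).Nonempty := (isGreatest_maxFun f x hf).1
  have := (hcl.isCompact.image (f := fun ω => inner ℝ (gradient (fun z => f z ω) x) h)
    (by fun_prop)).isGreatest_sSup (hne.image _)
  rwa [sSup_image'] at this

end

end ConeMinimax

/-! Robinson's condition says that the linearised system reaches every small `y`. A Baire category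
argument makes this quantitative with bounded data: a ball of some radius `r` lies in
`truncatedRange` (`exists_closedBall_subset_truncatedRange`). This one ball is used three times.

It drives a Newton-type iteration (`exists_correction_step`, `exists_feasible_near`) that repairs
almost feasible points at a cost proportional to the residual. Hence every linearised feasible
direction is followed, up to arbitrarily small error, by truly feasible points
(`exists_feasible_of_mem_linearised`). By a Danskin-type theorem `F` is Hadamard directionally
differentiable with the linearised objective as derivative (`tendsto_slope_maxFun`), so a negative
value of that objective would contradict local optimality.

It supplies the covering hypothesis of the M. Riesz extension theorem. The extension acts on the
cone of pairs `(a, D h - k)` with `a ≥ φ h` in `ℝ × Y`, where `φ` is the sublinear linearised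
objective; it yields a multiplier (`exists_multiplier`).

It bounds all multipliers by one constant (`norm_le_of_multiplier`). The same bound makes the
algebraic extension continuous and, with weak* closedness, gives compactness by Banach–Alaoglu. -/

namespace ConeMinimax

/-! ### Contingent cones of convex sets and of convex cones -/

section TangentCone

variable {X : Type*} [NormedAddCommGroup X] [NormedSpace ℝ X] {C : Set X} {x h : X}

/-- A convex set containing `x` and `x + a u` contains the whole segment between them. -/
theorem add_smul_mem_of_convex (hC : Convex ℝ C) (hx : x ∈ C) {a t : ℝ} {u : X}
    (ha : 0 < a) (hu : x + a • u ∈ C) (ht : 0 ≤ t) (hta : t ≤ a) : x + t • u ∈ C := by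
  have := hC.add_smul_mem hx hu (t := t / a) ⟨by positivity, (div_le_one ha).2 hta⟩
  rwa [smul_smul, div_mul_cancel₀ _ ha.ne'] at this

/-- Tangent directions of a convex set are the limits of feasible directions. -/
theorem mem_contingentCone_iff (hC : Convex ℝ C) (hx : x ∈ C) :
    h ∈ contingentCone C x ↔
      ∀ ε > 0, ∃ u : X, ‖u - h‖ < ε ∧ ∃ a : ℝ, 0 < a ∧ ∀ t : ℝ, 0 ≤ t → t ≤ a → x + t • u ∈ C := by
  constructor
  · rintro ⟨α, u, hα, -, hu, hmem⟩ ε hε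
    obtain ⟨n, hn⟩ := ((Metric.tendsto_nhds.1 hu) ε hε).exists
    exact ⟨u n, by rwa [← dist_eq_norm], α n, hα n, fun t ht hta =>
      add_smul_mem_of_convex hC hx (hα n) (hmem n) ht hta⟩
  · intro H
    have hpos : ∀ n : ℕ, (0 : ℝ) < 1 / ((n : ℝ) + 1) := fun n => by positivity
    choose u hu a ha hmem using fun n : ℕ => H _ (hpos n)
    have hlim : Tendsto (fun n : ℕ => 1 / ((n : ℝ) + 1)) atTop (𝓝 0) :=
      tendsto_one_div_add_atTop_nhds_zero_nat
    refine ⟨fun n => min (a n) (1 / ((n : ℝ) + 1)), u, fun n => lt_min (ha n) (hpos n),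
      squeeze_zero (fun n => (lt_min (ha n) (hpos n)).le) (fun n => min_le_right _ _) hlim,
      ?_, fun n => hmem n _ (lt_min (ha n) (hpos n)).le (min_le_left _ _)⟩
    rw [tendsto_iff_norm_sub_tendsto_zero]
    exact squeeze_zero (fun n => norm_nonneg _) (fun n => (hu n).le) hlim

theorem mem_contingentCone_of_add_smul_mem (hC : Convex ℝ C) (hx : x ∈ C) {a : ℝ} (ha : 0 < a)
    (hu : x + a • h ∈ C) : h ∈ contingentCone C x :=
  (mem_contingentCone_iff hC hx).2 fun ε hε => ⟨h, by simpa using hε, a, ha, fun _ ht hta =>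
    add_smul_mem_of_convex hC hx ha hu ht hta⟩

theorem sub_mem_contingentCone (hC : Convex ℝ C) (hx : x ∈ C) {y : X} (hy : y ∈ C) :
    y - x ∈ contingentCone C x :=
  mem_contingentCone_of_add_smul_mem hC hx one_pos (by simpa using hy)

theorem zero_mem_contingentCone (hC : Convex ℝ C) (hx : x ∈ C) : (0 : X) ∈ contingentCone C x := by
  simpa using sub_mem_contingentCone hC hx hx

theorem smul_mem_contingentCone (hC : Convex ℝ C) (hx : x ∈ C) {c : ℝ} (hc : 0 < c)
    (hh : h ∈ contingentCone C x) : c • h ∈ contingentCone C x := by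
  rw [mem_contingentCone_iff hC hx] at hh ⊢
  intro ε hε
  obtain ⟨u, hu, a, ha, hmem⟩ := hh (ε / c) (by positivity)
  refine ⟨c • u, ?_, a / c, by positivity, fun t ht hta => ?_⟩
  · rw [← smul_sub, norm_smul, Real.norm_of_nonneg hc.le, mul_comm]
    exact (lt_div_iff₀ hc).1 hu
  · rw [smul_smul]
    exact hmem _ (by positivity) ((le_div_iff₀ hc).1 hta)

theorem add_mem_contingentCone (hC : Convex ℝ C) (hx : x ∈ C) {k : X}
    (hh : h ∈ contingentCone C x) (hk : k ∈ contingentCone C x) :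
    h + k ∈ contingentCone C x := by
  rw [mem_contingentCone_iff hC hx] at hh hk ⊢
  intro ε hε
  obtain ⟨u, hu, a, ha, hmem⟩ := hh (ε / 2) (by positivity)
  obtain ⟨v, hv, b, hb, hmem'⟩ := hk (ε / 2) (by positivity)
  have hab : 0 < min a b / 2 := by have := lt_min ha hb; positivity
  refine ⟨u + v, ?_, min a b / 2, hab, fun t ht hta => ?_⟩
  · calc ‖u + v - (h + k)‖ = ‖(u - h) + (v - k)‖ := by congr 1; abel
      _ ≤ ‖u - h‖ + ‖v - k‖ := norm_add_le _ _
      _ < ε := by linarith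
  -- `x + t (u + v)` is the midpoint of `x + 2t u` and `x + 2t v`, hence the halved step length.
  · have h1 := hmem (2 * t) (by positivity) (by linarith [min_le_left a b])
    have h2 := hmem' (2 * t) (by positivity) (by linarith [min_le_right a b])
    have := hC h1 h2 (a := 1 / 2) (b := 1 / 2) (by norm_num) (by norm_num) (by norm_num)
    convert this using 1
    module

theorem add_mem_of_convex_of_cone (hC : Convex ℝ C) (hcone : ∀ t : ℝ, 0 < t → ∀ y ∈ C, t • y ∈ C)
    {y z : X} (hy : y ∈ C) (hz : z ∈ C) : y + z ∈ C := by
  have := hcone 2 two_pos _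
    (hC hy hz (a := 1 / 2) (b := 1 / 2) (by norm_num) (by norm_num) (by norm_num))
  convert this using 1
  module

theorem mem_contingentCone_of_cone (hC : Convex ℝ C)
    (hcone : ∀ t : ℝ, 0 < t → ∀ y ∈ C, t • y ∈ C) (hx : x ∈ C) (hh : h ∈ C) :
    h ∈ contingentCone C x :=
  mem_contingentCone_of_add_smul_mem hC hx one_pos
    (by simpa using add_mem_of_convex_of_cone hC hcone hx hh)

theorem neg_mem_contingentCone_of_cone (hC : Convex ℝ C)
    (hcone : ∀ t : ℝ, 0 < t → ∀ y ∈ C, t • y ∈ C) (hx : x ∈ C) :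
    -x ∈ contingentCone C x := by
  refine mem_contingentCone_of_add_smul_mem hC hx (a := 1 / 2) (by norm_num) ?_
  convert hcone (1 / 2) (by norm_num) x hx using 1
  module

end TangentCone

/-! ### Robinson's condition as a covered ball -/

section Robinson

variable {X Y : Type*} [NormedAddCommGroup X] [NormedSpace ℝ X] [NormedAddCommGroup Y]
  [NormedSpace ℝ Y] {A : Set X} {K : Set Y} {x : X} {y₀ : Y}

/-- The values `y₀ + D (a - x) - k` with `a ∈ A` in the unit ball around `x` and `k ∈ K`. -/
def truncatedRange (A : Set X) (K : Set Y) (D : X →L[ℝ] Y) (x : X) (y₀ : Y) : Set Y :=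
  {y | ∃ a ∈ A, ‖a - x‖ ≤ 1 ∧ ∃ k ∈ K, y = y₀ + D (a - x) - k}

theorem convex_truncatedRange (hA : Convex ℝ A) (hK : Convex ℝ K) (D : X →L[ℝ] Y) :
    Convex ℝ (truncatedRange A K D x y₀) := by
  rintro _ ⟨a, ha, han, k, hk, rfl⟩ _ ⟨b, hb, hbn, l, hl, rfl⟩ s t hs ht hst
  refine ⟨s • a + t • b, hA ha hb hs ht hst, ?_, s • k + t • l, hK hk hl hs ht hst, ?_⟩
  · have := convex_closedBall x (1 : ℝ) (by simpa [dist_eq_norm] using han)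
      (by simpa [dist_eq_norm] using hbn) hs ht hst
    simpa [dist_eq_norm] using this
  · obtain rfl : s = 1 - t := by linarith
    simp only [map_sub, map_add, map_smul]
    module

/-- The truncation to the unit ball pays off here: in a proper space the part coming from `A` is
compact, and compact plus closed is closed. -/
theorem isClosed_truncatedRange [ProperSpace X] (hA : IsClosed A) (hK : IsClosed K)
    (D : X →L[ℝ] Y) : IsClosed (truncatedRange A K D x y₀) := by
  have hc : IsCompact ((fun a => y₀ + D (a - x)) '' (A ∩ Metric.closedBall x 1)) :=
    ((isCompact_closedBall x 1).inter_left hA).image (by fun_prop)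
  convert hK.neg.add_right_of_isCompact hc using 1
  ext y
  constructor
  · rintro ⟨a, ha, han, k, hk, rfl⟩
    exact ⟨-k, by simpa using hk, _, ⟨a, ⟨ha, by simpa [dist_eq_norm] using han⟩, rfl⟩, by
      dsimp only; abel⟩
  · rintro ⟨k, hk, _, ⟨a, ⟨ha, han⟩, rfl⟩, rfl⟩
    exact ⟨a, ha, by simpa [dist_eq_norm] using han, -k, hk, by dsimp only; abel⟩

/-- Shrinking towards `(x, y₀)` shows that the truncated set still absorbs every direction. A closed
convex absorbing set in a Banach space is a neighbourhood of zero, by Baire. -/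
theorem exists_closedBall_subset_truncatedRange [ProperSpace X] [CompleteSpace Y]
    (hA : IsClosed A) (hA' : Convex ℝ A) (hK : IsClosed K) (hK' : Convex ℝ K) (D : X →L[ℝ] Y)
    (hx : x ∈ A) (hy₀ : y₀ ∈ K)
    (h : (0 : Y) ∈ interior {y | ∃ a ∈ A, ∃ k ∈ K, y = y₀ + D (a - x) - k}) :
    ∃ r > 0, ∀ y : Y, ‖y‖ ≤ r → y ∈ truncatedRange A K D x y₀ := by
  set S := truncatedRange A K D x y₀ with hS
  have hSc : Convex ℝ S := convex_truncatedRange hA' hK' D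
  have hScl : IsClosed S := isClosed_truncatedRange hA hK D
  have h0 : (0 : Y) ∈ S := ⟨x, hx, by simp, y₀, hy₀, by simp⟩
  have habs : ∀ y : Y, ∃ c : ℝ, 0 < c ∧ ∀ t : ℝ, 0 ≤ t → t ≤ c → t • y ∈ S := by
    intro y
    have hlim : Tendsto (fun t : ℝ => t • y) (𝓝[>] 0) (𝓝 0) := by
      have : Tendsto (fun t : ℝ => t • y) (𝓝 0) (𝓝 ((0 : ℝ) • y)) :=
        (continuous_id.smul continuous_const).tendsto 0
      rw [zero_smul] at this
      exact this.mono_left nhdsWithin_le_nhds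
    obtain ⟨c, ⟨a, ha, k, hk, hak⟩, hc⟩ :=
      ((hlim.eventually (mem_interior_iff_mem_nhds.1 h)).and self_mem_nhdsWithin).exists
    have hc : 0 < c := hc
    -- Contracting `a` towards `x` by the factor `m` brings it into the unit ball.
    set m : ℝ := (‖a - x‖ + 1)⁻¹ with hm
    have hm0 : 0 < m := by positivity
    have hm1 : m ≤ 1 := inv_le_one_of_one_le₀ (by linarith [norm_nonneg (a - x)])
    have hmem : (m * c) • y ∈ S := by
      refine ⟨x + m • (a - x), hA'.add_smul_sub_mem hx ha ⟨hm0.le, hm1⟩, ?_,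
        y₀ + m • (k - y₀), hK'.add_smul_sub_mem hy₀ hk ⟨hm0.le, hm1⟩, ?_⟩
      · rw [add_sub_cancel_left, norm_smul, Real.norm_of_nonneg hm0.le, hm,
          inv_mul_le_one₀ (by positivity)]
        linarith
      · rw [mul_smul, hak, add_sub_cancel_left, map_smul]
        module
    refine ⟨m * c, by positivity, fun t ht htc => ?_⟩
    have := add_smul_mem_of_convex hSc h0 (by positivity : 0 < m * c) (u := y)
      (by simpa using hmem) ht htc
    simpa using this
  -- Baire gives a ball around an unknown centre; symmetry of `T` allows recentring it at zero.
  set T : Set Y := S ∩ -S with hT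
  have hTcl : IsClosed T := hScl.inter hScl.neg
  have hTc : Convex ℝ T := hSc.inter hSc.neg
  have hTneg : ∀ y ∈ T, -y ∈ T := fun y hy => ⟨hy.2, by simpa using hy.1⟩
  have hcover : ⋃ n : ℕ, {y : Y | ((n : ℝ) + 1)⁻¹ • y ∈ T} = univ := by
    refine eq_univ_of_forall fun y => mem_iUnion.2 ?_
    obtain ⟨c, hc, hcS⟩ := habs y
    obtain ⟨c', hc', hcS'⟩ := habs (-y)
    obtain ⟨n, hn⟩ := exists_nat_gt (max c⁻¹ c'⁻¹)
    have h1 : ((n : ℝ) + 1)⁻¹ ≤ c :=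
      inv_le_of_inv_le₀ hc (by linarith [le_max_left c⁻¹ c'⁻¹])
    have h2 : ((n : ℝ) + 1)⁻¹ ≤ c' :=
      inv_le_of_inv_le₀ hc' (by linarith [le_max_right c⁻¹ c'⁻¹])
    exact ⟨n, hcS _ (by positivity) h1, by simpa using hcS' _ (by positivity) h2⟩
  obtain ⟨n, y, hy⟩ := nonempty_interior_of_iUnion_of_closed
    (fun n : ℕ => hTcl.preimage (continuous_const_smul (((n : ℝ) + 1)⁻¹))) hcover
  obtain ⟨ε, hε, hball⟩ := Metric.mem_nhds_iff.1 (mem_interior_iff_mem_nhds.1 hy)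
  have hn : (0 : ℝ) < (n : ℝ) + 1 := by positivity
  refine ⟨((n : ℝ) + 1)⁻¹ * (ε / 2), by positivity, fun z hz => ?_⟩
  set w := ((n : ℝ) + 1) • z with hw
  have hwn : ‖w‖ < ε := by
    rw [hw, norm_smul, Real.norm_of_nonneg hn.le]
    rw [le_inv_mul_iff₀ hn] at hz
    linarith
  have h1 : ((n : ℝ) + 1)⁻¹ • (y + w) ∈ T := hball (by simpa using hwn)
  have h2 : ((n : ℝ) + 1)⁻¹ • (y - w) ∈ T := hball (by simpa [dist_eq_norm] using hwn)
  -- The midpoint of the scaled `y + w` and `-(y - w)` no longer involves `y`.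
  have := hTc h1 (hTneg _ h2) (a := 1 / 2) (b := 1 / 2) (by norm_num) (by norm_num) (by norm_num)
  have hz' : z = ((n : ℝ) + 1)⁻¹ • w := by rw [hw, smul_smul, inv_mul_cancel₀ hn.ne', one_smul]
  rw [hz']
  convert this.1 using 1
  module

end Robinson

/-! ### Stability of the constraint system by Newton-type iteration -/

section Stability

variable {X Y : Type*} [NormedAddCommGroup X] [NormedSpace ℝ X] [NormedAddCommGroup Y]
  [NormedSpace ℝ Y] {A : Set X} {K : Set Y} {x : X} {G : X → Y} {D : X →L[ℝ] Y} {r δ : ℝ}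

/-- One Newton-type correction step halves the residual `G z - k`. -/
theorem exists_correction_step (hA : Convex ℝ A) (hK : Convex ℝ K) (hr : 0 < r) (hδ : δ ≤ 1)
    (hball : ∀ y : Y, ‖y‖ ≤ r → y ∈ truncatedRange A K D x (G x))
    (hG : ∀ p ∈ Metric.ball x δ, ∀ q ∈ Metric.ball x δ,
      ‖G p - G q - D (p - q)‖ ≤ r / 12 * ‖p - q‖)
    {z : X} {k : Y} (hz : z ∈ A) (hk : k ∈ K) (hzx : ‖z - x‖ + 4 / r * ‖G z - k‖ < δ)
    (he : ‖G z - k‖ ≤ r / 4) :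
    ∃ z' ∈ A, ∃ k' ∈ K, ‖z' - z‖ ≤ 2 / r * ‖G z - k‖ ∧ ‖G z' - k'‖ ≤ ‖G z - k‖ / 2 := by
  rcases (norm_nonneg (G z - k)).eq_or_lt with h0 | h0
  · exact ⟨z, hz, k, hk, by simp [← h0], by simp [← h0]⟩
  set e := ‖G z - k‖ with hedef
  -- With this `s` the vector `-(G z - k) / s` has norm exactly `r`, so the ball supplies `(a, b)`.
  -- Moving the fraction `s` of the way towards it cancels the residual to first order.
  set s := e / r with hs
  have hs0 : 0 < s := by positivity
  have hs1 : s ≤ 1 := by rw [hs, div_le_one hr]; linarith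
  have hzδ : ‖z - x‖ < δ := by
    have : 0 < 4 / r * e := by positivity
    linarith
  obtain ⟨a, ha, han, b, hb, hab⟩ := hball (-(s⁻¹ • (G z - k))) (by
    rw [norm_neg, norm_smul, norm_inv, Real.norm_of_nonneg hs0.le, ← hedef, hs, inv_div,
      div_mul_cancel₀ _ h0.ne'])
  have haz : ‖a - z‖ ≤ 2 := by
    calc ‖a - z‖ = ‖(a - x) - (z - x)‖ := by congr 1; abel
      _ ≤ ‖a - x‖ + ‖z - x‖ := norm_sub_le _ _
      _ ≤ 2 := by linarith
  have hstep : ‖z + s • (a - z) - z‖ ≤ 2 * s := by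
    rw [add_sub_cancel_left, norm_smul, Real.norm_of_nonneg hs0.le]
    nlinarith
  have h2s : 2 / r * e = 2 * s := by rw [hs]; ring
  have h4s : 4 / r * e = 4 * s := by rw [hs]; ring
  rw [h4s] at hzx
  refine ⟨z + s • (a - z), hA.add_smul_sub_mem hz ha ⟨hs0.le, hs1⟩,
    k + s • (b - k), hK.add_smul_sub_mem hk hb ⟨hs0.le, hs1⟩, by rwa [h2s], ?_⟩
  have hmem : z ∈ Metric.ball x δ := by rwa [mem_ball_iff_norm]
  have hxmem : x ∈ Metric.ball x δ := Metric.mem_ball_self (by linarith [norm_nonneg (z - x)])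
  have hmem' : z + s • (a - z) ∈ Metric.ball x δ := by
    rw [mem_ball_iff_norm]
    calc ‖z + s • (a - z) - x‖ = ‖(z + s • (a - z) - z) + (z - x)‖ := by congr 1; abel
      _ ≤ ‖z + s • (a - z) - z‖ + ‖z - x‖ := norm_add_le _ _
      _ < δ := by linarith
  have h1 := hG _ hmem' _ hmem
  have h2 := hG _ hmem _ hxmem
  have hsplit : G (z + s • (a - z)) - (k + s • (b - k)) =
      (G (z + s • (a - z)) - G z - D (z + s • (a - z) - z)) +
        s • ((G z - G x - D (z - x)) - (G z - k)) := by
    have hsab : s • (G x + D (a - x) - b) = -(G z - k) := by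
      rw [← hab, smul_neg, smul_smul, mul_inv_cancel₀ hs0.ne', one_smul]
    have hGz : G z = k - s • (G x + D (a - x) - b) := by rw [hsab]; abel
    have hlin : D (z + s • (a - z) - z) = s • (D a - D z) := by
      rw [add_sub_cancel_left, map_smul, map_sub]
    rw [hlin]
    simp only [map_sub] at hGz ⊢
    linear_combination (norm := module) hGz
  rw [hsplit]
  -- The contributions `r/6`, `r/12` and `r/4` add up to `r/2`, and `s * r/2 = e/2`; this fixes the
  -- constants `r / 12` and `r / 4` in the hypotheses.
  calc _ ≤ ‖G (z + s • (a - z)) - G z - D (z + s • (a - z) - z)‖ +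
        s * (‖G z - G x - D (z - x)‖ + e) := by
        refine (norm_add_le _ _).trans (add_le_add le_rfl ?_)
        rw [norm_smul, Real.norm_of_nonneg hs0.le]
        exact mul_le_mul_of_nonneg_left (norm_sub_le _ _) hs0.le
    _ ≤ r / 12 * (2 * s) + s * (r / 12 * 1 + r / 4) := by
        gcongr
        · exact h1.trans (by gcongr)
        · exact h2.trans (by gcongr; linarith)
    _ = e / 2 := by rw [hs]; field_simp; norm_num

/-- Stability of the system `z ∈ A`, `G z ∈ K` under Robinson's constraint qualification. -/
theorem exists_feasible_near [CompleteSpace X] (hA : IsClosed A) (hA' : Convex ℝ A)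
    (hK : IsClosed K) (hK' : Convex ℝ K) (hr : 0 < r)
    (hball : ∀ y : Y, ‖y‖ ≤ r → y ∈ truncatedRange A K D x (G x))
    (hG : HasStrictFDerivAt G D x) :
    ∃ c > 0, ∃ ε > 0, ∀ z ∈ A, ‖z - x‖ < ε → ∀ k ∈ K, ‖G z - k‖ < ε →
      ∃ z' ∈ A, G z' ∈ K ∧ ‖z' - z‖ ≤ c * ‖G z - k‖ := by
  obtain ⟨N, hN, happ⟩ := hG.approximates_deriv_on_nhds (c := (r / 12).toNNReal)
    (Or.inr (Real.toNNReal_pos.2 (by positivity)))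
  obtain ⟨δ', hδ', hsub⟩ := Metric.mem_nhds_iff.1 hN
  set δ := min δ' 1 with hδdef
  have hδ : 0 < δ := lt_min hδ' one_pos
  have hball_sub : Metric.ball x δ ⊆ N := (Metric.ball_subset_ball (min_le_left _ _)).trans hsub
  have happ' : ∀ p ∈ Metric.ball x δ, ∀ q ∈ Metric.ball x δ,
      ‖G p - G q - D (p - q)‖ ≤ r / 12 * ‖p - q‖ := fun p hp q hq => by
    simpa only [Real.coe_toNNReal _ (by positivity : 0 ≤ r / 12)] using
      happ p (hball_sub hp) q (hball_sub hq)
  refine ⟨4 / r, by positivity, min (δ / 2) (min (r / 4) (r * δ / 8)), by positivity, ?_⟩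
  intro z hz hzx k hk hzk
  simp only [lt_min_iff] at hzx hzk
  -- The iteration invariant: a step moves by at most `2 / r` times the residual, and halving the
  -- residual frees exactly that much of the budget `δ`.
  let S := {p : X × Y // p.1 ∈ A ∧ p.2 ∈ K ∧ ‖p.1 - x‖ + 4 / r * ‖G p.1 - p.2‖ < δ ∧
    ‖G p.1 - p.2‖ ≤ r / 4}
  have hstep : ∀ p : S, ∃ q : S, ‖q.1.1 - p.1.1‖ ≤ 2 / r * ‖G p.1.1 - p.1.2‖ ∧
      ‖G q.1.1 - q.1.2‖ ≤ ‖G p.1.1 - p.1.2‖ / 2 := by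
    rintro ⟨⟨p, b⟩, hp, hb, h1, h2⟩
    obtain ⟨p', hp', b', hb', h3, h4⟩ := exists_correction_step hA' hK' hr (min_le_right _ _)
      hball happ' hp hb h1 h2
    refine ⟨⟨⟨p', b'⟩, hp', hb', ?_, ?_⟩, h3, h4⟩
    · have h5 : ‖p' - x‖ ≤ ‖p' - p‖ + ‖p - x‖ := norm_sub_le_norm_sub_add_norm_sub _ _ _
      have h6 : 4 / r * ‖G p' - b'‖ ≤ 4 / r * (‖G p - b‖ / 2) := by gcongr
      have h7 : 4 / r * (‖G p - b‖ / 2) + 2 / r * ‖G p - b‖ = 4 / r * ‖G p - b‖ := by ring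
      dsimp only at h1 ⊢
      linarith
    · dsimp only at h2 ⊢
      linarith [norm_nonneg (G p - b)]
  choose next hnext1 hnext2 using hstep
  have hinit : ‖z - x‖ + 4 / r * ‖G z - k‖ < δ := by
    have : 4 / r * ‖G z - k‖ < 4 / r * (r * δ / 8) := by gcongr; exact hzk.2.2
    have h' : 4 / r * (r * δ / 8) = δ / 2 := by field_simp; norm_num
    linarith [hzx.1]
  let p : ℕ → S := fun n => next^[n] ⟨⟨z, k⟩, hz, hk, hinit, hzk.2.1.le⟩
  have hp : ∀ n, p (n + 1) = next (p n) := fun n => Function.iterate_succ_apply' _ _ _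
  have hres : ∀ n, ‖G (p n).1.1 - (p n).1.2‖ ≤ ‖G z - k‖ / 2 ^ n := by
    intro n
    induction n with
    | zero => simp [p]
    | succ n ih =>
      rw [hp]
      refine (hnext2 _).trans ?_
      rw [pow_succ, ← div_div]
      gcongr
  have hdist : ∀ n, dist (p n).1.1 (p (n + 1)).1.1 ≤ 4 / r * ‖G z - k‖ / 2 / 2 ^ n := by
    intro n
    rw [dist_comm, dist_eq_norm, hp]
    calc _ ≤ 2 / r * ‖G (p n).1.1 - (p n).1.2‖ := hnext1 _
      _ ≤ 2 / r * (‖G z - k‖ / 2 ^ n) := by gcongr; exact hres n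
      _ = _ := by ring
  obtain ⟨z', hz'⟩ := cauchySeq_tendsto_of_complete (cauchySeq_of_le_geometric_two hdist)
  have hzz' : ‖z' - z‖ ≤ 4 / r * ‖G z - k‖ := by
    have := dist_le_of_le_geometric_two_of_tendsto₀ hdist hz'
    rwa [dist_comm, dist_eq_norm] at this
  have hz'x : z' ∈ Metric.ball x δ := by
    rw [mem_ball_iff_norm]
    linarith [norm_sub_le_norm_sub_add_norm_sub z' z x]
  refine ⟨z', hA.mem_of_tendsto hz' (Eventually.of_forall fun n => (p n).2.1), ?_, hzz'⟩
  have hGc : ContinuousAt G z' := happ.continuousOn.continuousAt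
    (mem_of_superset (Metric.isOpen_ball.mem_nhds hz'x) hball_sub)
  have hres0 : Tendsto (fun n => G (p n).1.1 - (p n).1.2) atTop (𝓝 0) := by
    refine squeeze_zero_norm hres ?_
    simpa [div_eq_mul_inv] using
      (tendsto_pow_atTop_nhds_zero_of_lt_one (r := (2 : ℝ)⁻¹) (by norm_num) (by norm_num)).const_mul
        ‖G z - k‖
  have hlim := (hGc.tendsto.comp hz').sub hres0
  rw [sub_zero] at hlim
  refine hK.mem_of_tendsto hlim (Eventually.of_forall fun n => ?_)
  simpa using (p n).2.2.1

/-- Under Robinson's constraint qualification every feasible direction `h` of the linearised system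
is a limit of difference quotients of feasible points. -/
theorem exists_feasible_of_mem_linearised [CompleteSpace X] (hA : IsClosed A) (hA' : Convex ℝ A)
    (hK : IsClosed K) (hK' : Convex ℝ K) (hx : x ∈ A) (hGx : G x ∈ K) (hr : 0 < r)
    (hball : ∀ y : Y, ‖y‖ ≤ r → y ∈ truncatedRange A K D x (G x))
    (hG : HasStrictFDerivAt G D x) {h : X} (hh : h ∈ contingentCone A x)
    (hDh : D h ∈ contingentCone K (G x)) {η : ℝ} (hη : 0 < η) :
    ∀ᶠ t : ℝ in 𝓝[>] 0, ∃ u : X, ‖u - h‖ < η ∧ x + t • u ∈ A ∧ G (x + t • u) ∈ K := by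
  obtain ⟨c, hc, ε, hε, hstab⟩ := exists_feasible_near hA hA' hK hK' hr hball hG
  -- The residual at time `t` will be at most `t β (2 + ‖D‖)`; after correction the direction is off
  -- by at most `β + c β (2 + ‖D‖) = η / 2`.
  set β : ℝ := η / 2 / (1 + c * (2 + ‖D‖)) with hβ
  have hβ0 : 0 < β := by positivity
  obtain ⟨u, hu, a, ha, hua⟩ := (mem_contingentCone_iff hA' hx).1 hh β hβ0
  obtain ⟨v, hv, b, hb, hvb⟩ := (mem_contingentCone_iff hK' hGx).1 hDh β hβ0
  have hline : Tendsto (fun t : ℝ => x + t • u) (𝓝[>] 0) (𝓝 x) := by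
    have : Tendsto (fun t : ℝ => x + t • u) (𝓝 0) (𝓝 (x + (0 : ℝ) • u)) :=
      (by fun_prop : Continuous fun t : ℝ => x + t • u).tendsto 0
    rw [zero_smul, add_zero] at this
    exact this.mono_left nhdsWithin_le_nhds
  have hline' : Tendsto (fun t : ℝ => G (x + t • u) - (G x + t • v)) (𝓝[>] 0) (𝓝 0) := by
    have h1 := hG.continuousAt.tendsto.comp hline
    have : Tendsto (fun t : ℝ => G x + t • v) (𝓝 0) (𝓝 (G x + (0 : ℝ) • v)) :=
      (by fun_prop : Continuous fun t : ℝ => G x + t • v).tendsto 0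
    rw [zero_smul, add_zero] at this
    simpa using h1.sub (this.mono_left nhdsWithin_le_nhds)
  have hder : ∀ᶠ t : ℝ in 𝓝[>] 0, ‖G (x + t • u) - G x - t • D u‖ ≤ β * t := by
    have hd := (hG.hasFDerivAt.hasLineDerivAt u).hasDerivWithinAt (s := Ioi 0)
    filter_upwards [(hasDerivWithinAt_iff_isLittleO.1 hd).def hβ0, self_mem_nhdsWithin] with t ht ht0
    simpa [abs_of_pos (mem_Ioi.1 ht0)] using ht
  filter_upwards [self_mem_nhdsWithin, hder, Ioo_mem_nhdsGT ha, Ioo_mem_nhdsGT hb,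
    hline.eventually (Metric.ball_mem_nhds x hε),
    hline'.eventually (Metric.ball_mem_nhds 0 hε)] with t ht hdt hta htb hl hl'
  have ht : 0 < t := ht
  have hnear : ‖G (x + t • u) - (G x + t • v)‖ ≤ t * (β * (2 + ‖D‖)) := by
    have h1 : ‖D u - D h‖ ≤ ‖D‖ * β := by
      rw [← map_sub]
      exact (D.le_opNorm _).trans (by gcongr)
    calc _ = ‖(G (x + t • u) - G x - t • D u) + t • ((D u - D h) - (v - D h))‖ := by
          congr 1; module
      _ ≤ β * t + t * (‖D‖ * β + β) := by
          refine (norm_add_le _ _).trans (add_le_add hdt ?_)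
          rw [norm_smul, Real.norm_of_nonneg ht.le]
          gcongr
          exact (norm_sub_le _ _).trans (add_le_add h1 hv.le)
      _ = _ := by ring
  obtain ⟨z, hzA, hzK, hz⟩ := hstab _ (hua t ht.le hta.2.le) (by rwa [← mem_ball_iff_norm])
    _ (hvb t ht.le htb.2.le) (by rwa [← mem_ball_zero_iff])
  have hzt : x + t • (t⁻¹ • (z - x)) = z := by
    rw [smul_smul, mul_inv_cancel₀ ht.ne', one_smul]; abel
  refine ⟨t⁻¹ • (z - x), ?_, by rwa [hzt], by rwa [hzt]⟩
  have hsplit : t⁻¹ • (z - x) - h = t⁻¹ • (z - (x + t • u)) + (u - h) := by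
    have : t⁻¹ • (t • u) = u := by rw [smul_smul, inv_mul_cancel₀ ht.ne', one_smul]
    rw [smul_sub, smul_sub, smul_add, this]
    abel
  have hz1 : t⁻¹ * ‖z - (x + t • u)‖ ≤ c * (β * (2 + ‖D‖)) := by
    rw [inv_mul_le_iff₀ ht]
    calc _ ≤ c * ‖G (x + t • u) - (G x + t • v)‖ := hz
      _ ≤ c * (t * (β * (2 + ‖D‖))) := by gcongr
      _ = _ := by ring
  have hβη : β * (1 + c * (2 + ‖D‖)) = η / 2 := div_mul_cancel₀ _ (by positivity)
  rw [hsplit]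
  refine (norm_add_le _ _).trans_lt ?_
  rw [norm_smul, norm_inv, Real.norm_of_nonneg ht.le]
  linarith

end Stability

theorem hasDirDeriv_of_tendsto {X : Type*} [NormedAddCommGroup X] [NormedSpace ℝ X] {φ : X → ℝ}
    {x h : X} {D : ℝ}
    (H : Tendsto (fun p : ℝ × X => (φ (x + p.1 • p.2) - φ x) / p.1) (𝓝[>] 0 ×ˢ 𝓝 h) (𝓝 D)) :
    HasDirDeriv φ x h D := by
  have hpath : Tendsto (fun t : ℝ => (t, h)) (𝓝[>] 0) (𝓝[>] 0 ×ˢ 𝓝 h) :=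
    tendsto_id.prodMk tendsto_const_nhds
  have hcomp := H.comp hpath
  simp only [Function.comp_def] at hcomp
  unfold HasDirDeriv
  exact hcomp

/-! ### Directional derivative of the max-function -/

section Danskin

variable {E W : Type*} [NormedAddCommGroup E] [InnerProductSpace ℝ E] [CompleteSpace E]
  [TopologicalSpace W] {f : E → W → ℝ} {x h : E} {U : Set E}

/-- Difference quotients of `f(·, ω)` converge, also along a convergent family of parameters. -/
theorem tendsto_slope_of_tendsto (hU : IsOpen U) (hxU : x ∈ U)
    (hf_diff : ∀ z ∈ U, ∀ ω : W, DifferentiableAt ℝ (fun z' => f z' ω) z)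
    (hf_grad : ContinuousOn (fun p : E × W => gradient (fun z => f z p.2) p.1) (U ×ˢ univ))
    {l : Filter (ℝ × E)} (hl : l ≤ 𝓝[>] 0 ×ˢ 𝓝 h) {w : ℝ × E → W} {ω : W}
    (hw : Tendsto w l (𝓝 ω)) :
    Tendsto (fun p : ℝ × E => (f (x + p.1 • p.2) (w p) - f x (w p)) / p.1) l
      (𝓝 (inner ℝ (gradient (fun z => f z ω) x) h)) := by
  obtain ⟨ρ, hρ, hball⟩ := Metric.isOpen_iff.1 hU x hxU
  have hfst : Tendsto Prod.fst l (𝓝[>] (0 : ℝ)) := tendsto_fst.mono_left hl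
  have hfst' : Tendsto Prod.fst l (𝓝 (0 : ℝ)) := hfst.mono_right nhdsWithin_le_nhds
  have hsnd : Tendsto Prod.snd l (𝓝 h) := tendsto_snd.mono_left hl
  have hmove : Tendsto (fun p : ℝ × E => ‖p.1 • p.2‖) l (𝓝 0) := by
    simpa using (hfst'.smul hsnd).norm
  have hmvt : ∀ p : ℝ × E, ∃ ξ : E, ‖ξ - x‖ ≤ ‖p.1 • p.2‖ ∧ (‖p.1 • p.2‖ < ρ →
      f (x + p.1 • p.2) (w p) - f x (w p) =
        p.1 * inner ℝ (gradient (fun z => f z (w p)) ξ) p.2) := by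
    intro p
    by_cases hp : ‖p.1 • p.2‖ < ρ
    · obtain ⟨ξ, hξ, heq⟩ := domain_mvt (f := fun z => f z (w p)) (s := Metric.ball x ρ)
        (x := x) (y := x + p.1 • p.2)
        (fun z hz => (hf_diff z (hball hz) (w p)).hasGradientAt.hasFDerivAt.hasFDerivWithinAt)
        (convex_ball x ρ) (Metric.mem_ball_self hρ) (by simpa using hp)
      refine ⟨ξ, ?_, fun _ => ?_⟩
      · have := norm_sub_le_of_mem_segment hξ
        simpa using this
      · simpa [inner_smul_right] using heq
    -- Default value, so that `ξ` is total and tends to `x` without a case split.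
    · exact ⟨x, by simp, fun h => absurd h hp⟩
  choose ξ hξ hmv using hmvt
  have hξx : Tendsto ξ l (𝓝 x) := by
    rw [tendsto_iff_norm_sub_tendsto_zero]
    exact squeeze_zero (fun _ => norm_nonneg _) hξ hmove
  have hgrad : ContinuousAt (fun p : E × W => gradient (fun z => f z p.2) p.1) (x, ω) :=
    hf_grad.continuousAt (prod_mem_nhds (hU.mem_nhds hxU) univ_mem)
  have hlim : Tendsto (fun p => inner ℝ (gradient (fun z => f z (w p)) (ξ p)) p.2) l
      (𝓝 (inner ℝ (gradient (fun z => f z ω) x) h)) :=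
    (hgrad.tendsto.comp (hξx.prodMk_nhds hw)).inner hsnd
  refine hlim.congr' ?_
  filter_upwards [hfst.eventually self_mem_nhdsWithin,
    hmove.eventually (Iio_mem_nhds hρ)] with p hp hpρ
  rw [hmv p hpρ, mul_div_cancel_left₀ _ (ne_of_gt hp)]

variable [CompactSpace W] [Nonempty W]

/-- The objective is Hadamard directionally differentiable, and its directional derivative is the
linearised objective. -/
theorem tendsto_slope_maxFun (hU : IsOpen U) (hxU : x ∈ U)
    (hf : ContinuousOn (fun p : E × W => f p.1 p.2) (U ×ˢ univ))
    (hf_diff : ∀ z ∈ U, ∀ ω : W, DifferentiableAt ℝ (fun z' => f z' ω) z)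
    (hf_grad : ContinuousOn (fun p : E × W => gradient (fun z => f z p.2) p.1) (U ×ˢ univ)) :
    Tendsto (fun p : ℝ × E => (maxFun f (x + p.1 • p.2) - maxFun f x) / p.1) (𝓝[>] 0 ×ˢ 𝓝 h)
      (𝓝 (linearisedObjective f x h)) := by
  have hfc : ∀ z ∈ U, Continuous (f z) := fun z hz => continuousOn_univ.1
    (hf.comp (by fun_prop : Continuous fun ω : W => (z, ω)).continuousOn fun ω _ => ⟨hz, trivial⟩)
  have hgc : Continuous fun ω => gradient (fun z => f z ω) x := continuousOn_univ.1
    (hf_grad.comp (by fun_prop : Continuous fun ω : W => (x, ω)).continuousOn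
      fun ω _ => ⟨hxU, trivial⟩)
  have hmax : ∀ z ∈ U, IsGreatest (range (f z)) (maxFun f z) := fun z hz =>
    isGreatest_maxFun f z (hfc z hz)
  have hex : ∀ z, ∃ ω, z ∈ U → f z ω = maxFun f z := fun z => by
    by_cases hz : z ∈ U
    · obtain ⟨ω, hω⟩ := (hmax z hz).1
      exact ⟨ω, fun _ => hω⟩
    · exact ⟨Classical.arbitrary W, fun h => absurd h hz⟩
  choose w hw using hex
  have hlin := isGreatest_linearisedObjective f x h (hfc x hxU) hgc
  -- `W` need not be sequentially compact; along an ultrafilter the maximisers converge outright.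
  rw [tendsto_iff_ultrafilter]
  intro 𝒰 h𝒰
  have hfst : Tendsto Prod.fst (𝒰 : Filter (ℝ × E)) (𝓝[>] (0 : ℝ)) := tendsto_fst.mono_left h𝒰
  have hmove : Tendsto (fun p : ℝ × E => x + p.1 • p.2) 𝒰 (𝓝 x) := by
    simpa using ((hfst.mono_right nhdsWithin_le_nhds).smul
      (tendsto_snd.mono_left h𝒰)).const_add x
  have hmem : ∀ᶠ p : ℝ × E in 𝒰, x + p.1 • p.2 ∈ U := hmove.eventually (hU.mem_nhds hxU)
  have hpos : ∀ᶠ p : ℝ × E in 𝒰, 0 < p.1 := hfst.eventually self_mem_nhdsWithin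
  obtain ⟨ω, -, hω⟩ := isCompact_univ.ultrafilter_le_nhds
    (𝒰.map fun p : ℝ × E => w (x + p.1 • p.2)) (by simp)
  have hω' : Tendsto (fun p : ℝ × E => w (x + p.1 • p.2)) 𝒰 (𝓝 ω) := hω
  have hcont : ∀ ω' : W, ContinuousAt (fun p : E × W => f p.1 p.2) (x, ω') := fun ω' =>
    hf.continuousAt (prod_mem_nhds (hU.mem_nhds hxU) univ_mem)
  obtain ⟨ω₁, hω₁, hω₁h⟩ := hlin.1
  have hactive : ω ∈ activeSet f x := by
    refine le_antisymm ((hmax x hxU).2 ⟨ω, rfl⟩) ?_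
    rw [← show f x ω₁ = maxFun f x from hω₁]
    refine le_of_tendsto_of_tendsto
      ((hcont ω₁).tendsto.comp (hmove.prodMk_nhds tendsto_const_nhds))
      ((hcont ω).tendsto.comp (hmove.prodMk_nhds hω')) ?_
    filter_upwards [hmem] with p hp
    exact ((hmax _ hp).2 ⟨ω₁, rfl⟩).trans (hw _ hp).ge
  have hlow := tendsto_slope_of_tendsto hU hxU hf_diff hf_grad h𝒰
    (tendsto_const_nhds : Tendsto (fun _ => ω₁) _ _)
  have hupp := tendsto_slope_of_tendsto hU hxU hf_diff hf_grad h𝒰 hω'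
  dsimp only at hω₁h
  rw [hω₁h] at hlow
  -- Below: compare with the fixed active index `ω₁` attaining the linearised maximum. Above:
  -- compare with the moving maximisers, whose limit `ω` is active.
  refine tendsto_order.2 ⟨fun c hc => ?_, fun c hc => ?_⟩
  · filter_upwards [hlow.eventually (Ioi_mem_nhds hc), hmem, hpos] with p hp hpU hp0
    refine lt_of_lt_of_le hp ?_
    gcongr
    · exact (hmax _ hpU).2 ⟨ω₁, rfl⟩
    · exact (show f x ω₁ = maxFun f x from hω₁).ge
  · filter_upwards [hupp.eventually (Iio_mem_nhds ((hlin.2 ⟨ω, hactive, rfl⟩).trans_lt hc)),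
      hmem, hpos] with p hp hpU hp0
    refine lt_of_le_of_lt ?_ hp
    gcongr
    · exact (hw _ hpU).ge
    · exact (hmax x hxU).2 ⟨_, rfl⟩

theorem linearisedObjective_zero (hfx : Continuous (f x))
    (hgx : Continuous fun ω => gradient (fun z => f z ω) x) :
    linearisedObjective f x 0 = 0 := by
  obtain ⟨ω, -, hω⟩ := (isGreatest_linearisedObjective f x 0 hfx hgx).1
  simpa using hω.symm

theorem linearisedObjective_add_le (hfx : Continuous (f x))
    (hgx : Continuous fun ω => gradient (fun z => f z ω) x) (h k : E) :
    linearisedObjective f x (h + k) ≤ linearisedObjective f x h + linearisedObjective f x k := by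
  obtain ⟨ω, hω, hωh⟩ := (isGreatest_linearisedObjective f x (h + k) hfx hgx).1
  rw [← hωh]
  dsimp only
  rw [inner_add_right]
  exact add_le_add ((isGreatest_linearisedObjective f x h hfx hgx).2 ⟨ω, hω, rfl⟩)
    ((isGreatest_linearisedObjective f x k hfx hgx).2 ⟨ω, hω, rfl⟩)

theorem linearisedObjective_smul_le (hfx : Continuous (f x))
    (hgx : Continuous fun ω => gradient (fun z => f z ω) x) {c : ℝ} (hc : 0 ≤ c) (h : E) :
    linearisedObjective f x (c • h) ≤ c * linearisedObjective f x h := by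
  obtain ⟨ω, hω, hωh⟩ := (isGreatest_linearisedObjective f x (c • h) hfx hgx).1
  rw [← hωh]
  dsimp only
  rw [inner_smul_right]
  exact mul_le_mul_of_nonneg_left
    ((isGreatest_linearisedObjective f x h hfx hgx).2 ⟨ω, hω, rfl⟩) hc

theorem exists_linearisedObjective_le (hfx : Continuous (f x))
    (hgx : Continuous fun ω => gradient (fun z => f z ω) x) :
    ∃ C : ℝ, ∀ h : E, linearisedObjective f x h ≤ C * ‖h‖ := by
  obtain ⟨C, hC⟩ := (isCompact_range hgx).isBounded.exists_norm_le
  refine ⟨C, fun h => ?_⟩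
  obtain ⟨ω, -, hωh⟩ := (isGreatest_linearisedObjective f x h hfx hgx).1
  rw [← hωh]
  exact (real_inner_le_norm _ _).trans (by gcongr; exact hC _ ⟨ω, rfl⟩)

end Danskin

/-! ### Existence and uniform bounds for multipliers -/

section Multipliers

/-- An estimate, uniform in the multiplier, on a ball covered by the linearised system. -/
theorem norm_le_of_multiplier {E Y : Type*} [NormedAddCommGroup E] [NormedSpace ℝ E]
    [NormedAddCommGroup Y] [NormedSpace ℝ Y] {A : Set E} {K : Set Y} {x : E} {D : E →L[ℝ] Y} {φ : E → ℝ} {C r : ℝ} {y₀ : Y} (hA : Convex ℝ A) (hx : x ∈ A)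
    (hr : 0 < r) (hball : ∀ y : Y, ‖y‖ ≤ r → y ∈ truncatedRange A K D x y₀)
    (hφ : ∀ h, φ h ≤ C * ‖h‖) (hC : 0 ≤ C) {l : Y →ₗ[ℝ] ℝ} (hlK : ∀ k ∈ K, l k ≤ 0)
    (hly₀ : l y₀ = 0) (hl : ∀ h ∈ contingentCone A x, 0 ≤ φ h + l (D h)) (y : Y) :
    ‖l y‖ ≤ C / r * ‖y‖ := by
  have hlow : ∀ z : Y, ‖z‖ ≤ r → -C ≤ l z := by
    intro z hz
    obtain ⟨a, ha, han, k, hk, rfl⟩ := hball z hz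
    have h1 := hl _ (sub_mem_contingentCone hA hx ha)
    have h2 := hφ (a - x)
    have h3 := mul_le_mul_of_nonneg_left han hC
    have h4 := hlK k hk
    simp only [map_sub, map_add] at h1 ⊢
    linarith
  refine LinearMap.bound_of_ball_bound' hr C l (fun z hz => ?_) y
  rw [mem_closedBall_zero_iff] at hz
  have h1 := hlow z hz
  have h2 := hlow (-z) (by rwa [norm_neg])
  rw [map_neg] at h2
  rw [Real.norm_eq_abs, abs_le]
  exact ⟨h1, by linarith⟩

variable {E Y W : Type*} [NormedAddCommGroup E] [InnerProductSpace ℝ E] [CompleteSpace E]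
  [NormedAddCommGroup Y] [NormedSpace ℝ Y] {f : E → W → ℝ} {x : E} {A : Set E} {K : Set Y}
  {G : E → Y} {D : E →L[ℝ] Y}

/-- The Lagrangian has a directional derivative in every direction, and limits are unique. The
existential clause thus becomes an inequality affine in `l`, on which convexity and closedness rest.
-/
theorem mem_lagrangeMultipliers_iff
    (hF : ∀ h, HasDirDeriv (maxFun f) x h (linearisedObjective f x h))
    (hG : HasFDerivAt G D x) {l : StrongDual ℝ Y} :
    l ∈ lagrangeMultipliers A K f G x ↔ l ∈ polarCone K ∧ l (G x) = 0 ∧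
      ∀ h ∈ contingentCone A x, 0 ≤ linearisedObjective f x h + l (D h) := by
  have key : ∀ h, HasDirDeriv (fun z => lagrangian f G z l) x h
      (linearisedObjective f x h + l (D h)) := by
    intro h
    have h1 : HasDerivAt (fun t : ℝ => l (G (x + t • h))) (l (D h)) 0 :=
      l.hasFDerivAt.comp_hasDerivAt 0 (hG.hasLineDerivAt h)
    have h2 := h1.hasDerivWithinAt (s := Ioi 0)
    rw [hasDerivWithinAt_iff_tendsto_slope' (by simp)] at h2
    refine ((hF h).add h2).congr fun t => ?_
    simp only [slope_def_field, lagrangian, zero_smul, add_zero, sub_zero]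
    ring
  refine and_congr_right fun _ => and_congr_right fun _ => forall₂_congr fun h _ => ?_
  constructor
  · rintro ⟨d, hd, hd0⟩
    rwa [← tendsto_nhds_unique hd (key h)]
  · exact fun h0 => ⟨_, key h, h0⟩

/-- Existence of a multiplier for a sublinear objective that is nonnegative on the feasible
directions of the linearised system. -/
theorem exists_multiplier {E Y : Type*} [NormedAddCommGroup E] [NormedSpace ℝ E]
    [NormedAddCommGroup Y] [NormedSpace ℝ Y] {A : Set E} {K : Set Y} {x : E} {D : E →L[ℝ] Y} {φ : E → ℝ} {C r : ℝ} {y₀ : Y} (hA : Convex ℝ A) (hx : x ∈ A)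
    (hK : Convex ℝ K) (hcone : ∀ t : ℝ, 0 < t → ∀ y ∈ K, t • y ∈ K) (hy₀ : y₀ ∈ K)
    (hr : 0 < r) (hball : ∀ y : Y, ‖y‖ ≤ r → y ∈ truncatedRange A K D x y₀)
    (hφ : ∀ h, φ h ≤ C * ‖h‖) (hC : 0 ≤ C) (hφ0 : φ 0 = 0)
    (hφadd : ∀ h k, φ (h + k) ≤ φ h + φ k) (hφsmul : ∀ c : ℝ, 0 ≤ c → ∀ h, φ (c • h) ≤ c * φ h)
    (hopt : ∀ h ∈ contingentCone A x, D h ∈ contingentCone K y₀ → 0 ≤ φ h) :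
    ∃ l : StrongDual ℝ Y, l ∈ polarCone K ∧ l y₀ = 0 ∧
      ∀ h ∈ contingentCone A x, 0 ≤ φ h + l (D h) := by
  let s : PointedCone ℝ (ℝ × Y) := ConvexCone.toPointedCone
    { carrier := {p | ∃ h ∈ contingentCone A x, ∃ k ∈ contingentCone K y₀,
        p.2 = D h - k ∧ φ h ≤ p.1}
      smul_mem' := by
        rintro c hc p ⟨h, hh, k, hk, hp, hle⟩
        refine ⟨c • h, smul_mem_contingentCone hA hx hc hh, c • k,
          smul_mem_contingentCone hK hy₀ hc hk, ?_, ?_⟩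
        · rw [Prod.smul_snd, hp, map_smul, smul_sub]
        · exact (hφsmul c hc.le h).trans (mul_le_mul_of_nonneg_left hle hc.le)
      add_mem' := by
        rintro p ⟨h, hh, k, hk, hp, hle⟩ q ⟨h', hh', k', hk', hq, hle'⟩
        refine ⟨h + h', add_mem_contingentCone hA hx hh hh', k + k',
          add_mem_contingentCone hK hy₀ hk hk', ?_, ?_⟩
        · rw [Prod.snd_add, hp, hq, map_add]
          abel
        · exact (hφadd h h').trans (add_le_add hle hle') }
    ⟨0, zero_mem_contingentCone hA hx, 0, zero_mem_contingentCone hK hy₀, by simp, by simp [hφ0]⟩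
  have hs : ∀ p : ℝ × Y, p ∈ s ↔ ∃ h ∈ contingentCone A x, ∃ k ∈ contingentCone K y₀,
      p.2 = D h - k ∧ φ h ≤ p.1 := fun _ => Iff.rfl
  -- The functional to extend is the first coordinate on the axis `ℝ × {0}`; on the part of the axis
  -- in `s` it is nonnegative by `hopt`.
  let g₀ : (ℝ × Y) →ₗ.[ℝ] ℝ :=
    ⟨Submodule.prod ⊤ ⊥, (LinearMap.fst ℝ ℝ Y).domRestrict (Submodule.prod ⊤ ⊥)⟩
  obtain ⟨g, hg, hgs⟩ := riesz_extension s g₀ (by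
    rintro ⟨⟨a, y⟩, hay⟩ hmem
    obtain rfl : y = 0 := hay.2
    obtain ⟨h, hh, k, hk, hp, hle⟩ := (hs _).1 hmem
    have hDk : D h = k := (sub_eq_zero.1 hp.symm)
    exact (hopt h hh (hDk ▸ hk)).trans hle) (by
    rintro ⟨b, y⟩
    -- `y / c` falls into the covered ball, and the `+ 1` keeps `c` positive when `y = 0`. Then `y =
    -- D (c (a - x)) - c (k - y₀)`, so a shift of the first coordinate puts `(b, y)` into the cone.
    set c : ℝ := (‖y‖ + 1) / r with hc
    have hc0 : 0 < c := by positivity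
    obtain ⟨a, ha, -, k, hk, hy⟩ := hball (c⁻¹ • y) (by
      rw [norm_smul, norm_inv, Real.norm_of_nonneg hc0.le, inv_mul_le_iff₀ hc0, hc,
        div_mul_cancel₀ _ hr.ne']
      linarith)
    refine ⟨⟨(φ (c • (a - x)) - b, 0), trivial, rfl⟩, (hs _).2 ⟨c • (a - x),
      smul_mem_contingentCone hA hx hc0 (sub_mem_contingentCone hA hx ha), c • (k - y₀),
      smul_mem_contingentCone hK hy₀ hc0 (sub_mem_contingentCone hK hy₀ hk), ?_, by simp⟩⟩
    have hy' : y = c • (y₀ + D (a - x) - k) := by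
      rw [← hy, smul_smul, mul_inv_cancel₀ hc0.ne', one_smul]
    rw [map_smul, Prod.snd_add, zero_add, hy']
    module)
  let l : Y →ₗ[ℝ] ℝ := g.comp (LinearMap.inr ℝ ℝ Y)
  have hgl : ∀ a y, g (a, y) = a + l y := by
    intro a y
    have h1 : g (a, 0) = a := hg ⟨(a, 0), trivial, rfl⟩
    have h2 : g (a, y) = g (a, 0) + g (0, y) := by rw [← map_add]; simp
    rw [h2, h1]
    rfl
  have hl : ∀ h ∈ contingentCone A x, ∀ k ∈ contingentCone K y₀, 0 ≤ φ h + l (D h - k) := by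
    intro h hh k hk
    rw [← hgl]
    exact hgs _ ((hs _).2 ⟨h, hh, k, hk, rfl, le_rfl⟩)
  have hlT : ∀ k ∈ contingentCone K y₀, l k ≤ 0 := by
    intro k hk
    have := hl 0 (zero_mem_contingentCone hA hx) k hk
    simp only [hφ0, map_zero, zero_sub, map_neg, zero_add] at this
    linarith
  have hlK : ∀ k ∈ K, l k ≤ 0 := fun k hk => hlT k (mem_contingentCone_of_cone hK hcone hy₀ hk)
  have hly₀ : l y₀ = 0 := by
    have := hlT _ (neg_mem_contingentCone_of_cone hK hcone hy₀)
    rw [map_neg] at this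
    linarith [hlK y₀ hy₀]
  have hlA : ∀ h ∈ contingentCone A x, 0 ≤ φ h + l (D h) := fun h hh => by
    simpa using hl h hh 0 (zero_mem_contingentCone hK hy₀)
  -- The Riesz extension is only algebraic; continuity comes from the uniform estimate.
  exact ⟨l.mkContinuous (C / r) (norm_le_of_multiplier hA hx hr hball hφ hC hlK hly₀ hlA),
    hlK, hly₀, hlA⟩

end Multipliers

/-! ### Convexity and weak* closedness of the multiplier set -/

section Compactness

variable {E Y : Type*} [NormedAddCommGroup E] [NormedSpace ℝ E] [NormedAddCommGroup Y]
  [NormedSpace ℝ Y] {K : Set Y} {T : Set E} {D : E →L[ℝ] Y} {y₀ : Y} {φ : E → ℝ}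

theorem convex_multipliers :
    Convex ℝ {l : StrongDual ℝ Y | l ∈ polarCone K ∧ l y₀ = 0 ∧ ∀ h ∈ T, 0 ≤ φ h + l (D h)} := by
  rintro l ⟨hlK, hl0, hl⟩ m ⟨hmK, hm0, hm⟩ a b ha hb hab
  refine ⟨fun k hk => ?_, by simp [hl0, hm0], fun h hh => ?_⟩
  · have h1 := mul_nonpos_of_nonneg_of_nonpos ha (hlK k hk)
    have h2 := mul_nonpos_of_nonneg_of_nonpos hb (hmK k hk)
    simpa using add_nonpos h1 h2
  · have h1 := mul_nonneg ha (hl h hh)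
    have h2 := mul_nonneg hb (hm h hh)
    obtain rfl : a = 1 - b := by linarith
    simp only [add_apply, smul_apply, smul_eq_mul]
    linarith

/-- Each condition tests `l` at one fixed vector, and evaluations are weak* continuous. -/
theorem isClosed_toWeakDual_image_multipliers :
    IsClosed (StrongDual.toWeakDual ''
      {l : StrongDual ℝ Y | l ∈ polarCone K ∧ l y₀ = 0 ∧ ∀ h ∈ T, 0 ≤ φ h + l (D h)}) := by
  have heq : StrongDual.toWeakDual ''
      {l : StrongDual ℝ Y | l ∈ polarCone K ∧ l y₀ = 0 ∧ ∀ h ∈ T, 0 ≤ φ h + l (D h)} =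
      (⋂ k ∈ K, {l : WeakDual ℝ Y | l k ≤ 0}) ∩ ({l : WeakDual ℝ Y | l y₀ = 0} ∩
        ⋂ h ∈ T, {l : WeakDual ℝ Y | 0 ≤ φ h + l (D h)}) := by
    ext l
    simp only [mem_inter_iff, mem_iInter, mem_ofPred_eq]
    constructor
    · rintro ⟨l, hl, rfl⟩
      exact hl
    · exact fun hl => ⟨WeakDual.toStrongDual l, hl, rfl⟩
  rw [heq]
  have hev : ∀ y : Y, Continuous fun l : WeakDual ℝ Y => l y := WeakDual.eval_continuous
  exact (isClosed_biInter fun k _ => isClosed_le (hev k) continuous_const).inter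
    ((isClosed_eq (hev y₀) continuous_const).inter
      (isClosed_biInter fun h _ => isClosed_le continuous_const
        (continuous_const.add (hev (D h)))))

end Compactness

end ConeMinimax

/-! ### The main theorem -/

theorem mainTheorem6 {d : ℕ}
    {Y : Type*} [NormedAddCommGroup Y] [NormedSpace ℝ Y] [CompleteSpace Y]
    {W : Type*} [TopologicalSpace W] [CompactSpace W] [T2Space W] [Nonempty W]
    (A : Set (EuclideanSpace ℝ (Fin d))) (hA_closed : IsClosed A) (hA_convex : Convex ℝ A)
    (K : Set Y) (hK_closed : IsClosed K) (hK_convex : Convex ℝ K)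
    (hK_cone : ∀ t : ℝ, 0 < t → ∀ y ∈ K, t • y ∈ K)
    (f : EuclideanSpace ℝ (Fin d) → W → ℝ) (G : EuclideanSpace ℝ (Fin d) → Y)
    (x : EuclideanSpace ℝ (Fin d))
    -- the smoothness assumptions are only needed on an open neighbourhood `U` of `x`
    (U : Set (EuclideanSpace ℝ (Fin d))) (hU : IsOpen U) (hxU : x ∈ U)
    (hf : ContinuousOn (fun p : EuclideanSpace ℝ (Fin d) × W => f p.1 p.2) (U ×ˢ Set.univ))
    (hf_diff : ∀ z ∈ U, ∀ ω : W, DifferentiableAt ℝ (fun z' => f z' ω) z)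
    (hf_grad : ContinuousOn
      (fun p : EuclideanSpace ℝ (Fin d) × W => gradient (fun z => f z p.2) p.1) (U ×ˢ Set.univ))
    (hG : ContDiffOn ℝ 1 G U)
    -- `x` is a locally optimal solution of `min F` over the feasible region
    (hx_feas : x ∈ ConeMinimax.feasibleSet A K G)
    (hx_min : IsLocalMinOn (ConeMinimax.maxFun f) (ConeMinimax.feasibleSet A K G) x)
    (hRCQ : ConeMinimax.RCQ A K G x) :
    -- `h = 0` is a globally optimal solution of the linearised problem
    ((0 : EuclideanSpace ℝ (Fin d)) ∈ ConeMinimax.linearisedFeasibleSet A K G x ∧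
      IsMinOn (ConeMinimax.linearisedObjective f x)
        (ConeMinimax.linearisedFeasibleSet A K G x) 0) ∧
    -- the set of Lagrange multipliers is nonempty, convex, bounded and weak* compact
    ((ConeMinimax.lagrangeMultipliers A K f G x).Nonempty ∧
      Convex ℝ (ConeMinimax.lagrangeMultipliers A K f G x) ∧
      Bornology.IsBounded (ConeMinimax.lagrangeMultipliers A K f G x) ∧
      IsCompact (StrongDual.toWeakDual '' ConeMinimax.lagrangeMultipliers A K f G x)) := by
  open ConeMinimax in
  obtain ⟨hxA, hGx⟩ := hx_feas
  have hGd : HasStrictFDerivAt G (fderiv ℝ G x) x :=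
    (hG.contDiffAt (hU.mem_nhds hxU)).hasStrictFDerivAt one_ne_zero
  have hfx : Continuous (f x) := continuousOn_univ.1
    (hf.comp (by fun_prop : Continuous fun ω : W => (x, ω)).continuousOn fun ω _ => ⟨hxU, trivial⟩)
  have hgx : Continuous fun ω => gradient (fun z => f z ω) x := continuousOn_univ.1
    (hf_grad.comp (by fun_prop : Continuous fun ω : W => (x, ω)).continuousOn
      fun ω _ => ⟨hxU, trivial⟩)
  have hslope := fun h => tendsto_slope_maxFun (h := h) hU hxU hf hf_diff hf_grad
  have hF : ∀ h, HasDirDeriv (maxFun f) x h (linearisedObjective f x h) := fun h =>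
    hasDirDeriv_of_tendsto (hslope h)
  obtain ⟨r, hr, hball⟩ := exists_closedBall_subset_truncatedRange hA_closed hA_convex hK_closed
    hK_convex (fderiv ℝ G x) hxA hGx hRCQ
  obtain ⟨C₀, hC₀⟩ := exists_linearisedObjective_le hfx hgx
  have hC : ∀ h, linearisedObjective f x h ≤ max C₀ 0 * ‖h‖ := fun h =>
    (hC₀ h).trans (by gcongr; exact le_max_left _ _)
  have hopt : ∀ h ∈ contingentCone A x, fderiv ℝ G x h ∈ contingentCone K (G x) →
      0 ≤ linearisedObjective f x h := by
    intro h hh hDh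
    by_contra! hneg
    -- Hadamard differentiability keeps the quotient negative for all `u` within `η` of `h`, which
    -- leaves room for the feasible correction of `h`.
    obtain ⟨P, hP, Q, hQ, hPQ⟩ := eventually_prod_iff.1 ((hslope h).eventually (Iio_mem_nhds hneg))
    obtain ⟨η, hη, hQη⟩ := Metric.eventually_nhds_iff.1 hQ
    have hmin : ∀ᶠ z in 𝓝 x, z ∈ feasibleSet A K G → maxFun f x ≤ maxFun f z :=
      eventually_nhdsWithin_iff.1 hx_min
    obtain ⟨ε, hε, hminε⟩ := Metric.eventually_nhds_iff.1 hmin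
    have hsmall : ∀ᶠ t : ℝ in 𝓝[>] 0, t * (‖h‖ + η) < ε := by
      have : Tendsto (fun t : ℝ => t * (‖h‖ + η)) (𝓝[>] 0) (𝓝 (0 * (‖h‖ + η))) :=
        ((continuous_id.mul continuous_const).tendsto 0).mono_left nhdsWithin_le_nhds
      rw [zero_mul] at this
      exact this.eventually (Iio_mem_nhds hε)
    obtain ⟨t, ⟨u, hu, huA, huK⟩, hPt, ht, hts⟩ :=
      ((exists_feasible_of_mem_linearised hA_closed hA_convex hK_closed hK_convex hxA hGx hr hball
        hGd hh hDh hη).and (hP.and (Eventually.and self_mem_nhdsWithin hsmall))).exists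
    have ht : 0 < t := ht
    have hlt : (maxFun f (x + t • u) - maxFun f x) / t < 0 := hPQ hPt (hQη (by rwa [dist_eq_norm]))
    refine absurd hlt (not_lt.2 (div_nonneg (sub_nonneg.2 (hminε ?_ ⟨huA, huK⟩)) ht.le))
    rw [dist_eq_norm, add_sub_cancel_left, norm_smul, Real.norm_of_nonneg ht.le]
    refine lt_of_le_of_lt ?_ hts
    gcongr
    linarith [norm_sub_norm_le u h]
  have hset : lagrangeMultipliers A K f G x = {l : StrongDual ℝ Y | l ∈ polarCone K ∧
      l (G x) = 0 ∧ ∀ h ∈ contingentCone A x,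
        0 ≤ linearisedObjective f x h + l (fderiv ℝ G x h)} :=
    Set.ext fun l => mem_lagrangeMultipliers_iff hF hGd.hasFDerivAt
  have hbdd : Bornology.IsBounded (lagrangeMultipliers A K f G x) := by
    refine isBounded_iff_forall_norm_le.2 ⟨max C₀ 0 / r, fun l hl => ?_⟩
    rw [hset] at hl
    exact l.opNorm_le_bound (by positivity) fun y => norm_le_of_multiplier (l := l.toLinearMap)
      hA_convex hxA hr hball hC (le_max_right _ _) hl.1 hl.2.1 hl.2.2 y
  refine ⟨⟨⟨zero_mem_contingentCone hA_convex hxA, ?_⟩, fun h hh => ?_⟩, ?_, ?_, hbdd, ?_⟩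
  · rw [map_zero]
    exact zero_mem_contingentCone hK_convex hGx
  · rw [mem_ofPred_eq, linearisedObjective_zero hfx hgx]
    exact hopt h hh.1 hh.2
  · rw [hset]
    exact exists_multiplier hA_convex hxA hK_convex hK_cone hGx hr hball hC (le_max_right _ _)
      (linearisedObjective_zero hfx hgx) (linearisedObjective_add_le hfx hgx)
      (fun c hc => linearisedObjective_smul_le hfx hgx hc) hopt
  · rw [hset]
    exact convex_multipliers
  · refine WeakDual.isCompact_of_bounded_of_closed ?_ ?_
    · rw [← WeakDual.isBounded_toWeakDual_preimage_iff_isBounded,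
        preimage_image_eq _ StrongDual.toWeakDual.injective]
      exact hbdd
    · rw [hset]
      exact isClosed_toWeakDual_image_multipliers
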